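/- Let $N\ge 1$ and $M\ge 0$ be integers, let $k_1<\dots<k_M$ be positive integers with $k_M<N$ (no condition if $M=0$), and put $\Lambda=\{0,\dots,N\}\setminus\{k_1,\dots,k_M\}$. Let $\mathcal P(\Lambda)$ be the space of polynomials $\sum_{k\in\Lambda}c_kz^k$ with complex coefficients, normed as a subspace of $L^1(\mathbb T)$ by $\|f\|_1=\frac1{2\pi}\int_{\mathbb T}|f(\zeta)|\,|d\zeta|$, where $\mathbb T=\{|\zeta|=1\}$. A point $\xi$ of the closed unit ball $\mathrm{ball}(X)$ of a complex normed space $X$ is called exposed if there is $\phi\in X^*$ with $\|\phi\|=1$ and $\{x\in\mathrm{ball}(X):\phi(x)=1\}=\{\xi\}$. Let $p(z)=\sum_{k=0}^Nc_kz^k\in\mathcal P(\Lambda)$ with $\|p\|_1=1$, and put $p^*(z)=\sum_{k=0}^N\overline{c_k}z^{N-k}$. Let $a_1,\dots,a_n$ be the distinct common zeros of $p$ and $p^*$ in the open unit disk, and let $m_j$ be the minimum of the multiplicities of $a_j$ as a zero of $p$ and of $p^*$. Let $\zeta_1,\dots,\zeta_\nu$ be the distinct zeros of $p$ on $\mathbb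 T$, of multiplicities $\lambda_1,\dots,\lambda_\nu$, and let $\mu_j=\lfloor\lambda_j/2\rfloor$. Put $\widetilde m=\sum_jm_j+\sum_j\mu_j$, $$G(z)=\prod_{j=1}^n(z-a_j)^{m_j}(1-\overline{a_j}z)^{m_j},\qquad G_0(z)=\prod_{j=1}^\nu(z-\zeta_j)^{\mu_j}(1-\overline{\zeta_j}z)^{\mu_j},\qquad \widetilde G=GG_0,$$ and let $\widetilde R=p/\widetilde G$, which is a polynomial. For $k\in\mathbb Z$ let $\widetilde C_k$ be the coefficient of $z^k$ in $\widetilde R$ (zero if $k<0$ or $k>\deg\widetilde R$), and put $\widetilde A(k)=\operatorname{Re}\widetilde C_k$, $\widetilde B(k)=\operatorname{Im}\widetilde C_k$. For $1\le j\le M$ and $0\le l\le\widetilde m$ put $$\widetilde A^{\pm}_{j,l}=\widetilde A(k_j+l-\widetilde m)\pm\widetilde A(k_j-l-\widetilde m),\qquad \widetilde B^{\pm}_{j,l}=\widetilde B(k_j+l-\widetilde m)\pm\widetilde B(k_j-l-\widetilde m).$$ Let $\widetilde{\mathcal A}^+,\widetilde{\mathcal B}^+$ be the $M\times(\widetilde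 m+1)$ matrices with entries $\widetilde A^+_{j,l},\widetilde B^+_{j,l}$ $(0\le l\le\widetilde m)$, let $\widetilde{\mathcal A}^-,\widetilde{\mathcal B}^-$ be the $M\times\widetilde m$ matrices with entries $\widetilde A^-_{j,l},\widetilde B^-_{j,l}$ $(1\le l\le\widetilde m)$, and let $$\widetilde{\mathfrak M}=\begin{pmatrix}\widetilde{\mathcal A}^+&\widetilde{\mathcal B}^-\\ \widetilde{\mathcal B}^+&-\widetilde{\mathcal A}^-\end{pmatrix},\qquad \widetilde{\mathcal N}=\ker\widetilde{\mathfrak M}\subset\mathbb R^{2\widetilde m+1}.$$ For an integer $d\ge0$, a vector $(\alpha_0,\dots,\alpha_d,\beta_1,\dots,\beta_d)\in\mathbb R^{2d+1}$ is called a plus-vector if $\alpha_0+\sum_{k=1}^d(\alpha_k\cos kt-\beta_k\sin kt)\ge0$ for all $t\in(-\pi,\pi]$, and the plus-dimension $\dim_+V$ of a subspace $V\subset\mathbb R^{2d+1}$ is the maximum number of linearly independent plus-vectors in $V$. Then $p$ is an exposed point of $\mathrm{ball}(\mathcal P(\Lambda))$ if and only if $\dim_+\widetilde{\mathcal N}=1$.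 -/

import Mathlib

open Polynomial MeasureTheory Real

noncomputable section

namespace Fewnomial

/-- A circle of length `2π`, parametrized by arc length `t`; the point with parameter `t` is
`AddCircle.toCircle t = exp (i t)`. -/
abbrev Arc : Type := AddCircle (2 * π)

instance arcPos : Fact (0 < 2 * π) := ⟨Real.two_pi_pos⟩

/-- `L¹(𝕋)` with respect to the normalized Lebesgue measure `|dζ| / 2π`. -/
abbrev L1 : Type := Lp ℂ 1 (AddCircle.haarAddCircle : Measure Arc)

/-- The restriction of a polynomial to the unit circle, as a continuous function. -/
def onCircle : ℂ[X] →ₗ[ℂ] C(Arc, ℂ) where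
  toFun p := ⟨fun t => p.eval (AddCircle.toCircle t : ℂ),
    p.continuous.comp (continuous_subtype_val.comp AddCircle.continuous_toCircle)⟩
  map_add' p q := by ext t; simp
  map_smul' c p := by ext t; simp

/-- The embedding of polynomials in `L¹(𝕋)`. -/
def toL1 : ℂ[X] →ₗ[ℂ] L1 :=
  (ContinuousMap.toLp (E := ℂ) 1 (AddCircle.haarAddCircle : Measure Arc) ℂ).toLinearMap ∘ₗ onCircle

/-- `Λ = {0, …, N} \ {k₁, …, k_M}`. -/
def freq (N : ℕ) {M : ℕ} (k : Fin M → ℕ) : Finset ℕ :=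
  Finset.range (N + 1) \ Finset.univ.image k

/-- `𝒫(Λ)`: the polynomials `∑ c_k z^k` with `k` running through `Λ`. -/
def fewnomials (Λ : Finset ℕ) : Submodule ℂ ℂ[X] where
  carrier := {p | p.support ⊆ Λ}
  zero_mem' := by simp
  add_mem' {p q} hp hq := Polynomial.support_add.trans (Finset.union_subset hp hq)
  smul_mem' c p hp := (Polynomial.support_smul c p).trans hp

/-- `𝒫(Λ)` as a normed space, namely as a subspace of `L¹(𝕋)`. -/
abbrev fewnomialsL1 (Λ : Finset ℕ) : Submodule ℂ L1 := (fewnomials Λ).map toL1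

/-- `ξ` is an exposed point of the closed unit ball of the complex normed space `X`: some
functional of norm `1` takes the value `1` on the ball at `ξ` and nowhere else. -/
def IsExposedPointOfBall {X : Type*} [NormedAddCommGroup X] [NormedSpace ℂ X] (ξ : X) : Prop :=
  ∃ φ : X →L[ℂ] ℂ, ‖φ‖ = 1 ∧ {x : X | ‖x‖ ≤ 1 ∧ φ x = 1} = {ξ}

/-- `p*(z) = ∑_{k ≤ N} conj (c_k) z^(N-k)` for `p(z) = ∑_{k ≤ N} c_k z^k`. -/
def pstar (N : ℕ) (p : ℂ[X]) : ℂ[X] := (p.map (starRingEnd ℂ)).reflect N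

/-- The distinct common zeros `a_j` of `p` and `p*` in the open unit disk (for `p ≠ 0`). -/
def diskZeros (N : ℕ) (p : ℂ[X]) : Finset ℂ :=
  open Classical in {a ∈ p.roots.toFinset | (pstar N p).IsRoot a ∧ ‖a‖ < 1}

/-- `m_j`, as a function of the point `a_j`. -/
def diskMult (N : ℕ) (p : ℂ[X]) (a : ℂ) : ℕ :=
  min (p.rootMultiplicity a) ((pstar N p).rootMultiplicity a)

/-- The distinct zeros `ζ_j` of `p` on the unit circle (for `p ≠ 0`). -/
def circleZeros (p : ℂ[X]) : Finset ℂ :=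
  open Classical in {ζ ∈ p.roots.toFinset | ‖ζ‖ = 1}

/-- `μ_j = [λ_j / 2]`, as a function of the point `ζ_j`. -/
def circleMult (p : ℂ[X]) (ζ : ℂ) : ℕ := p.rootMultiplicity ζ / 2

/-- `m̃ = ∑ m_j + ∑ μ_j`. -/
def mTilde (N : ℕ) (p : ℂ[X]) : ℕ :=
  ∑ a ∈ diskZeros N p, diskMult N p a + ∑ ζ ∈ circleZeros p, circleMult p ζ

/-- `G(z) = ∏ (z - a_j)^{m_j} (1 - conj(a_j) z)^{m_j}`. -/
def G (N : ℕ) (p : ℂ[X]) : ℂ[X] :=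
  ∏ a ∈ diskZeros N p,
    (X - C a) ^ diskMult N p a * (1 - C (starRingEnd ℂ a) * X) ^ diskMult N p a

/-- `G₀(z) = ∏ (z - ζ_j)^{μ_j} (1 - conj(ζ_j) z)^{μ_j}`. -/
def G₀ (p : ℂ[X]) : ℂ[X] :=
  ∏ ζ ∈ circleZeros p,
    (X - C ζ) ^ circleMult p ζ * (1 - C (starRingEnd ℂ ζ) * X) ^ circleMult p ζ

/-- `G̃ = G G₀`. -/
def GTilde (N : ℕ) (p : ℂ[X]) : ℂ[X] := G N p * G₀ p

/-- `R̃ = p / G̃`; for `p ≠ 0` of degree at most `N` the division has no remainder. -/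
def RTilde (N : ℕ) (p : ℂ[X]) : ℂ[X] := p / GTilde N p

/-- The Fourier coefficients `C̃_k` (`k ∈ ℤ`) of `R̃`. -/
def CTilde (N : ℕ) (p : ℂ[X]) (k : ℤ) : ℂ := if 0 ≤ k then (RTilde N p).coeff k.toNat else 0

/-- `Ã(k) = Re C̃_k`. -/
def ATilde (N : ℕ) (p : ℂ[X]) (k : ℤ) : ℝ := (CTilde N p k).re

/-- `B̃(k) = Im C̃_k`. -/
def BTilde (N : ℕ) (p : ℂ[X]) (k : ℤ) : ℝ := (CTilde N p k).im

/-- The matrix with entries `f(k_j + l - d) + f(k_j - l - d)`, `l = 0, …, d`. -/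
def plusMatrix {M : ℕ} (k : Fin M → ℕ) (d : ℕ) (f : ℤ → ℝ) : Matrix (Fin M) (Fin (d + 1)) ℝ :=
  Matrix.of fun j l => f ((k j : ℤ) + (l : ℤ) - (d : ℤ)) + f ((k j : ℤ) - (l : ℤ) - (d : ℤ))

/-- The matrix with entries `f(k_j + l - d) - f(k_j - l - d)`, `l = 1, …, d`; the column with
index `i : Fin d` is the one for `l = i + 1`. -/
def minusMatrix {M : ℕ} (k : Fin M → ℕ) (d : ℕ) (f : ℤ → ℝ) : Matrix (Fin M) (Fin d) ℝ :=
  Matrix.of fun j i =>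
    f ((k j : ℤ) + ((i : ℤ) + 1) - (d : ℤ)) - f ((k j : ℤ) - ((i : ℤ) + 1) - (d : ℤ))

/-- The block matrix with block rows `(Ã⁺, B̃⁻)` and `(B̃⁺, -Ã⁻)`, of size `2M × (2m̃ + 1)`. -/
def MTilde (N : ℕ) {M : ℕ} (k : Fin M → ℕ) (p : ℂ[X]) :
    Matrix (Fin M ⊕ Fin M) (Fin (mTilde N p + 1) ⊕ Fin (mTilde N p)) ℝ :=
  Matrix.fromBlocks
    (plusMatrix k (mTilde N p) (ATilde N p)) (minusMatrix k (mTilde N p) (BTilde N p))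
    (plusMatrix k (mTilde N p) (BTilde N p)) (-minusMatrix k (mTilde N p) (ATilde N p))

/-- `Ñ = ker M̃`, a subspace of `ℝ^(2m̃ + 1)`. -/
def NTilde (N : ℕ) {M : ℕ} (k : Fin M → ℕ) (p : ℂ[X]) :
    Submodule ℝ (Fin (mTilde N p + 1) ⊕ Fin (mTilde N p) → ℝ) :=
  LinearMap.ker (MTilde N k p).mulVecLin

/-- Plus-vectors. The vector `(α₀, α₁, …, α_d, β₁, …, β_d)` is `v`, with `α_l = v (inl l)` and
`β_(i+1) = v (inr i)`. -/
def IsPlusVector {d : ℕ} (v : Fin (d + 1) ⊕ Fin d → ℝ) : Prop :=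
  ∀ t ∈ Set.Ioc (-π) π,
    0 ≤ v (Sum.inl 0) + ∑ i : Fin d,
      (v (Sum.inl i.succ) * cos (((i : ℝ) + 1) * t) - v (Sum.inr i) * sin (((i : ℝ) + 1) * t))

/-- The numbers `n` such that `V` contains `n` linearly independent plus-vectors. -/
def plusCounts {d : ℕ} (V : Submodule ℝ (Fin (d + 1) ⊕ Fin d → ℝ)) : Set ℕ :=
  {n | ∃ w : Fin n → (Fin (d + 1) ⊕ Fin d → ℝ),
    LinearIndependent ℝ w ∧ ∀ i, w i ∈ V ∧ IsPlusVector (w i)}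

/-- The plus-dimension: the maximum number of linearly independent plus-vectors in `V`. -/
def plusDim {d : ℕ} (V : Submodule ℝ (Fin (d + 1) ⊕ Fin d → ℝ)) : ℕ := sSup (plusCounts V)

/-- The supremum in the definition of the plus-dimension is a maximum. -/
theorem isGreatest_plusDim {d : ℕ} (V : Submodule ℝ (Fin (d + 1) ⊕ Fin d → ℝ)) :
    IsGreatest (plusCounts V) (plusDim V) := by
  have hb : BddAbove (plusCounts V) := by
    refine ⟨Module.finrank ℝ (Fin (d + 1) ⊕ Fin d → ℝ), ?_⟩
    rintro n ⟨w, hw, -⟩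
    simpa using hw.fintype_card_le_finrank
  exact ⟨Nat.sSup_mem ⟨0, Fin.elim0, linearIndependent_empty_type, fun i => i.elim0⟩ hb,
    fun n hn => le_csSup hb hn⟩

end Fewnomial

end

/-!
Since `p ≠ 0` almost everywhere, the norming functional of `p` in `L¹` is unique, so `p` is exposed
if and only if its real multiples are the only `f ∈ 𝒫(Λ)` with `f conj p ≥ 0` on the circle, that
is, with `f / p ≥ 0` there. The zeros of such an `f` are constrained by those of `p`: on the circle
the multiplicities have the same parity, and elsewhere `f p* = f* p`, so that `f` vanishes wherever
`p` does to a higher order than `p*`. Hence `f = Q R̃`, where on the circle `Q` is `z ^ m̃` times a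
nonnegative trigonometric polynomial of degree at most `m̃`. Conversely, every product of this form
is such an `f`, provided that its coefficients at the `k_j` vanish; these are linear conditions on
the plus-vector of the trigonometric polynomial, and their matrix is `M̃`.
-/

namespace Fewnomial

open scoped ComplexConjugate ComplexOrder ENNReal
open Filter Topology

section LebesgueSpace

variable {α : Type*} [MeasurableSpace α] {μ : Measure α}

/-- For almost every `t` the difference `‖n • g t‖ - ‖n • g t - f t‖` equals `‖f t‖` as soon as
`n ‖g t‖ ≥ ‖f t‖`. -/
theorem tendsto_norm_nsmul_sub_norm_nsmul_sub {E : Type*} [NormedAddCommGroup E] [NormedSpace ℝ E]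
    {f g : Lp E 1 μ} (hg : ∀ᵐ t ∂μ, g t ≠ 0) (h : ∀ᵐ t ∂μ, SameRay ℝ (f t) (g t)) :
    Tendsto (fun n : ℕ => ‖n • g‖ - ‖n • g - f‖) atTop (𝓝 ‖f‖) := by
  have hdiff (n : ℕ) : ‖n • g‖ - ‖n • g - f‖ = ∫ t, ‖(n • g) t‖ - ‖(n • g - f) t‖ ∂μ := by
    rw [integral_sub (L1.integrable_coeFn _).norm (L1.integrable_coeFn _).norm,
      ← L1.norm_eq_integral_norm, ← L1.norm_eq_integral_norm]
  have hcoe : ∀ᵐ t ∂μ, ∀ n : ℕ, (n • g) t = n • g t ∧ (n • g - f) t = n • g t - f t := by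
    refine ae_all_iff.2 fun n => ?_
    rw [← Nat.cast_smul_eq_nsmul ℝ n g]
    filter_upwards [Lp.coeFn_smul (n : ℝ) g, Lp.coeFn_sub ((n : ℝ) • g) f] with t hsmul hsub
    rw [hsub, Pi.sub_apply, hsmul, Pi.smul_apply, Nat.cast_smul_eq_nsmul]
    exact ⟨rfl, rfl⟩
  simp only [hdiff, L1.norm_eq_integral_norm f]
  refine tendsto_integral_of_dominated_convergence (fun t => ‖f t‖)
    (fun n => ((L1.integrable_coeFn _).norm.sub (L1.integrable_coeFn _).norm).aestronglyMeasurable)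
    (L1.integrable_coeFn f).norm (fun n => ?_) ?_
  · filter_upwards [hcoe] with t ht
    rw [(ht n).1, (ht n).2, Real.norm_eq_abs]
    simpa using abs_norm_sub_norm_le (n • g t) (n • g t - f t)
  · filter_upwards [hcoe, hg, h] with t ht hgt hray
    refine tendsto_const_nhds.congr' ?_
    filter_upwards [eventually_ge_atTop ⌈‖f t‖ / ‖g t‖⌉₊] with n hn
    have hle : ‖f t‖ ≤ ‖n • g t‖ := by
      rw [RCLike.norm_nsmul ℝ, nsmul_eq_mul]
      exact (div_le_iff₀ (norm_pos_iff.2 hgt)).1 (Nat.ceil_le.1 hn)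
    have hray' : SameRay ℝ (n • g t) (f t) := by
      rw [← Nat.cast_smul_eq_nsmul ℝ]
      exact hray.symm.nonneg_smul_left n.cast_nonneg
    rw [(ht n).1, (ht n).2, hray'.norm_sub, abs_of_nonneg (sub_nonneg.2 hle), sub_sub_cancel]

theorem sameRay_of_mul_conj_nonneg {w z : ℂ} (h : 0 ≤ w * conj z) : SameRay ℝ w z := by
  have hnorm : inner ℝ w z = ‖w‖ * ‖z‖ := by
    rw [real_inner_comm, Complex.inner, Complex.re_eq_norm.2 h, norm_mul, Complex.norm_conj]
  rw [sameRay_iff_norm_smul_eq, inner_eq_norm_mul_iff_real.1 hnorm]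

theorem eq_ofReal_of_norm_le_of_le_re {w : ℂ} {r : ℝ} (h : ‖w‖ ≤ r) (h' : r ≤ w.re) : w = r := by
  have hre : w.re = r := ((Complex.re_le_norm w).trans h).antisymm h'
  have hnonneg : 0 ≤ w := Complex.re_eq_norm.1 ((Complex.re_le_norm w).antisymm (h.trans h'))
  rw [Complex.eq_re_of_ofReal_le hnonneg, hre]

theorem apply_eq_norm_of_mul_conj_nonneg {V : Submodule ℂ (Lp ℂ 1 μ)} {φ : V →L[ℂ] ℂ}
    (hφ : ‖φ‖ ≤ 1) {p f : V} (hφp : φ p = ‖p‖) (hp : ∀ᵐ t ∂μ, (p : Lp ℂ 1 μ) t ≠ 0)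
    (hf : ∀ᵐ t ∂μ, 0 ≤ (f : Lp ℂ 1 μ) t * conj ((p : Lp ℂ 1 μ) t)) : φ f = ‖f‖ := by
  have hle (g : V) : ‖φ g‖ ≤ ‖g‖ :=
    (φ.le_of_opNorm_le hφ g).trans_eq (one_mul _)
  refine eq_ofReal_of_norm_le_of_le_re (hle f) ?_
  refine le_of_tendsto' (tendsto_norm_nsmul_sub_norm_nsmul_sub hp
    (hf.mono fun t => sameRay_of_mul_conj_nonneg)) fun n => ?_
  calc ‖n • (p : Lp ℂ 1 μ)‖ - ‖n • (p : Lp ℂ 1 μ) - f‖ = n * ‖p‖ - ‖n • p - f‖ := by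
        rw [RCLike.norm_nsmul ℝ, nsmul_eq_mul]
        rfl
    _ ≤ n * ‖p‖ - (φ (n • p - f)).re := by
        gcongr
        exact (Complex.re_le_norm _).trans (hle _)
    _ = (φ f).re := by
        rw [map_sub, map_nsmul, hφp]
        simp

theorem exists_clm_apply_eq_integral_mul {u : α → ℂ} (hu : AEStronglyMeasurable u μ)
    (hu₁ : ∀ᵐ t ∂μ, ‖u t‖ ≤ 1) :
    ∃ φ : Lp ℂ 1 μ →L[ℂ] ℂ, ‖φ‖ ≤ 1 ∧ ∀ f : Lp ℂ 1 μ, φ f = ∫ t, f t * u t ∂μ := by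
  have hmem : MemLp u ∞ μ := memLp_top_of_bound hu 1 hu₁
  let φ := (ContinuousLinearMap.lpPairing μ 1 ∞ (ContinuousLinearMap.mul ℂ ℂ)).flip
    (hmem.toLp u)
  have hφ (f : Lp ℂ 1 μ) : φ f = ∫ t, f t * u t ∂μ := by
    rw [ContinuousLinearMap.flip_apply, ContinuousLinearMap.lpPairing_eq_integral]
    refine integral_congr_ae (hmem.coeFn_toLp.mono fun t ht => ?_)
    simp only [ContinuousLinearMap.mul_apply', ht]
  refine ⟨φ, φ.opNorm_le_bound zero_le_one fun f => ?_, hφ⟩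
  rw [hφ, one_mul, L1.norm_eq_integral_norm]
  refine norm_integral_le_of_norm_le (L1.integrable_coeFn f).norm (hu₁.mono fun t ht => ?_)
  rw [norm_mul]
  exact mul_le_of_le_one_right (norm_nonneg _) ht

theorem ae_eq_of_integral_eq_of_norm_le {F : α → ℂ} {r : α → ℝ} (hF : Integrable F μ)
    (hr : Integrable r μ) (hle : ∀ᵐ t ∂μ, ‖F t‖ ≤ r t) (h : ∫ t, F t ∂μ = ∫ t, r t ∂μ) :
    ∀ᵐ t ∂μ, F t = r t := by
  have hnonneg : ∀ᵐ t ∂μ, 0 ≤ r t - (F t).re :=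
    hle.mono fun t ht => sub_nonneg.2 ((Complex.re_le_norm _).trans ht)
  have hFre : Integrable (fun t => (F t).re) μ := hF.re
  have hre : ∫ t, (F t).re ∂μ = ∫ t, r t ∂μ := by
    simpa [h] using integral_re hF
  have hzero : ∫ t, (r t - (F t).re) ∂μ = 0 := by
    rw [integral_sub hr hFre, hre, sub_self]
  filter_upwards [hle, (integral_eq_zero_iff_of_nonneg_ae hnonneg (hr.sub hFre)).1 hzero]
    with t ht h₀
  exact eq_ofReal_of_norm_le_of_le_re ht (sub_eq_zero.1 h₀).le

/-- The functional is `f ↦ ∫ f conj p / |p|`. -/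
theorem exists_clm_apply_eq_norm_and_mul_conj_nonneg (p : Lp ℂ 1 μ) :
    ∃ φ : Lp ℂ 1 μ →L[ℂ] ℂ, ‖φ‖ ≤ 1 ∧ φ p = ‖p‖ ∧
      ∀ f : Lp ℂ 1 μ, φ f = ‖f‖ → ∀ᵐ t ∂μ, 0 ≤ f t * conj (p t) := by
  let u (t : α) : ℂ := conj (p t) / ‖p t‖
  have hp : AEStronglyMeasurable p μ := (Lp.stronglyMeasurable p).aestronglyMeasurable
  have hu : AEStronglyMeasurable u μ := by
    exact (Complex.continuous_conj.comp_aestronglyMeasurable hp).div₀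
      (Complex.continuous_ofReal.comp_aestronglyMeasurable hp.norm)
  have hu₁ (t : α) : ‖u t‖ ≤ 1 := by
    simp only [u, norm_div, Complex.norm_conj, Complex.norm_real, norm_norm]
    exact div_self_le_one _
  obtain ⟨φ, hφ, hφu⟩ := exists_clm_apply_eq_integral_mul hu (.of_forall hu₁)
  refine ⟨φ, hφ, ?_, fun f hf => ?_⟩
  · have hpu (t : α) : p t * u t = ‖p t‖ := by
      rw [← mul_div_assoc, Complex.mul_conj', pow_two, mul_self_div_self]
    simp only [hφu, hpu, integral_complex_ofReal, L1.norm_eq_integral_norm]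
  · have hfu : ∀ᵐ t ∂μ, f t * u t = ‖f t‖ := by
      refine ae_eq_of_integral_eq_of_norm_le
        ((L1.integrable_coeFn f).mul_bdd hu (.of_forall hu₁)) (L1.integrable_coeFn f).norm
        (.of_forall fun t => ?_) ?_
      · rw [norm_mul]
        exact mul_le_of_le_one_right (norm_nonneg _) (hu₁ t)
      · rw [← hφu, hf, L1.norm_eq_integral_norm]
    filter_upwards [hfu] with t ht
    have hconj : conj (p t) = u t * ‖p t‖ := by
      rcases eq_or_ne (p t) 0 with h₀ | h₀
      · simp [h₀]
      · rw [div_mul_cancel₀ _ (by simpa using h₀)]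
    rw [hconj, ← mul_assoc, ht, ← Complex.ofReal_mul, Complex.zero_le_real]
    positivity

theorem isExposedPointOfBall_iff {V : Submodule ℂ (Lp ℂ 1 μ)} {p : V} (hp₁ : ‖p‖ = 1)
    (hp : ∀ᵐ t ∂μ, (p : Lp ℂ 1 μ) t ≠ 0) :
    IsExposedPointOfBall p ↔
      ∀ f : V, (∀ᵐ t ∂μ, 0 ≤ (f : Lp ℂ 1 μ) t * conj ((p : Lp ℂ 1 μ) t)) →
        ∃ c : ℝ, f = c • p := by
  constructor
  · rintro ⟨φ, hφ, hexp⟩ f hf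
    have hφp : φ p = 1 := (hexp.ge rfl).2
    have hφf : φ f = ‖f‖ :=
      apply_eq_norm_of_mul_conj_nonneg hφ.le (by rw [hφp, hp₁, Complex.ofReal_one]) hp hf
    rcases eq_or_ne f 0 with rfl | hf₀
    · exact ⟨0, (zero_smul ℝ p).symm⟩
    · have hnorm : ‖f‖ ≠ 0 := norm_ne_zero_iff.2 hf₀
      have hmem : ‖f‖⁻¹ • f ∈ {x : V | ‖x‖ ≤ 1 ∧ φ x = 1} := by
        constructor
        · rw [norm_smul, norm_inv, norm_norm, inv_mul_cancel₀ hnorm]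
        · rw [φ.map_smul_of_tower, hφf, Complex.real_smul, ← Complex.ofReal_mul,
            inv_mul_cancel₀ hnorm, Complex.ofReal_one]
      rw [hexp] at hmem
      exact ⟨‖f‖, (inv_smul_eq_iff₀ hnorm).1 hmem⟩
  · intro h
    obtain ⟨ψ, hψ, hψp, hψf⟩ := exists_clm_apply_eq_norm_and_mul_conj_nonneg (p : Lp ℂ 1 μ)
    let φ : V →L[ℂ] ℂ := ψ.comp V.subtypeL
    have hφp : φ p = 1 := hψp.trans (congrArg Complex.ofReal hp₁)
    have hle (f : V) : ‖φ f‖ ≤ ‖f‖ := (ψ.le_of_opNorm_le hψ _).trans_eq (one_mul _)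
    refine ⟨φ, (φ.opNorm_le_bound zero_le_one (by simpa using hle)).antisymm ?_, ?_⟩
    · simpa [hφp, hp₁] using φ.le_opNorm p
    · refine Set.eq_singleton_iff_unique_mem.2 ⟨⟨hp₁.le, hφp⟩, fun f ⟨hf₁, hφf⟩ => ?_⟩
      have hnorm : ‖f‖ = 1 := hf₁.antisymm (by simpa [hφf] using hle f)
      obtain ⟨c, rfl⟩ := h f (hψf f (hφf.trans (congrArg Complex.ofReal hnorm).symm))
      rw [φ.map_smul_of_tower, hφp, Complex.real_smul, mul_one, Complex.ofReal_eq_one] at hφf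
      rw [hφf, one_smul]

end LebesgueSpace

/-! ### The conjugate reciprocal polynomial -/

theorem pstar_ne_zero {N : ℕ} {f : ℂ[X]} (hf : f ≠ 0) : pstar N f ≠ 0 := by
  rw [pstar, Ne, reflect_eq_zero_iff]
  exact (Polynomial.map_ne_zero_iff (starRingEnd ℂ).injective).2 hf

theorem coeff_pstar (N : ℕ) (f : ℂ[X]) {i : ℕ} (hi : i ≤ N) :
    (pstar N f).coeff i = conj (f.coeff (N - i)) := by
  simp [pstar, revAt_le hi]

theorem natDegree_pstar_le {N : ℕ} {f : ℂ[X]} (hf : f.natDegree ≤ N) :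
    (pstar N f).natDegree ≤ N :=
  natDegree_reflect_le.trans (by simpa [natDegree_map] using hf)

theorem pstar_pstar (N : ℕ) (f : ℂ[X]) : pstar N (pstar N f) = f := by
  ext i
  simp [pstar]

theorem pstar_mul {A B : ℕ} {f g : ℂ[X]} (hf : f.natDegree ≤ A) (hg : g.natDegree ≤ B) :
    pstar (A + B) (f * g) = pstar A f * pstar B g := by
  simp only [pstar, Polynomial.map_mul]
  exact reflect_mul _ _ (by simpa [natDegree_map] using hf) (by simpa [natDegree_map] using hg)

theorem pstar_X_sub_C_pow (a : ℂ) (r : ℕ) :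
    pstar r ((X - C a) ^ r) = (1 - C (conj a) * X) ^ r := by
  induction r with
  | zero => simp [pstar]
  | succ r ih =>
    rw [pow_succ, pstar_mul (by simp) (natDegree_X_sub_C a).le, ih, pow_succ]
    congr 1
    simp [pstar, reflect_sub]

theorem eval_pstar {N : ℕ} {f : ℂ[X]} (hf : f.natDegree ≤ N) {z : ℂ} (hz : ‖z‖ = 1) :
    (pstar N f).eval z = z ^ N * conj (f.eval z) := by
  have hz₀ : z ≠ 0 := norm_pos_iff.1 (hz ▸ one_pos)
  let : Invertible (conj z) := invertibleOfNonzero ((_root_.map_ne_zero _).2 hz₀)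
  have hinv : ⅟(conj z) = z := by rw [invOf_eq_inv, ← Complex.inv_eq_conj hz, inv_inv]
  have hreflect := eval₂_reflect_mul_pow (RingHom.id ℂ) (conj z) N (f.map (starRingEnd ℂ))
    (by simpa [natDegree_map] using hf)
  rw [hinv, eval₂_id, eval₂_id, eval_map, eval₂_hom] at hreflect
  rw [← hreflect, mul_left_comm, ← mul_pow, Complex.mul_conj', hz]
  simp [pstar]

/-- Reflection exchanges the zero at the origin and the one at infinity. -/
theorem rootMultiplicity_zero_pstar {N : ℕ} {f : ℂ[X]} (hf : f ≠ 0) (hN : f.natDegree ≤ N) :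
    (pstar N f).rootMultiplicity 0 + f.natDegree = N := by
  have htrail : (pstar N f).natTrailingDegree = N - f.natDegree := by
    apply le_antisymm
    · apply natTrailingDegree_le_of_ne_zero
      rw [coeff_pstar _ _ (Nat.sub_le _ _), Nat.sub_sub_self hN]
      simpa using hf
    · refine le_natTrailingDegree (pstar_ne_zero hf) fun i hi => ?_
      rw [coeff_pstar _ _ (by lia), coeff_eq_zero_of_natDegree_lt (by lia), map_zero]
  rw [rootMultiplicity_eq_natTrailingDegree', htrail, Nat.sub_add_cancel hN]

theorem rootMultiplicity_le_rootMultiplicity_pstar {N : ℕ} {f : ℂ[X]} (hf : f ≠ 0)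
    (hN : f.natDegree ≤ N) {a : ℂ} (ha : a ≠ 0) :
    f.rootMultiplicity a ≤ (pstar N f).rootMultiplicity (conj a)⁻¹ := by
  have hconj : conj a ≠ 0 := (_root_.map_ne_zero _).2 ha
  rw [le_rootMultiplicity_iff (pstar_ne_zero hf)]
  obtain ⟨u, hu⟩ := pow_rootMultiplicity_dvd f a
  set r := f.rootMultiplicity a
  have hu₀ : u ≠ 0 := right_ne_zero_of_mul (hu ▸ hf)
  have hdeg : r + u.natDegree = f.natDegree := by
    conv_rhs => rw [hu, natDegree_mul (pow_ne_zero _ (X_sub_C_ne_zero a)) hu₀]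
    simp
  have hfactor : pstar N f = (1 - C (conj a) * X) ^ r * pstar (N - r) u := by
    rw [← pstar_X_sub_C_pow, ← pstar_mul (by simp) (by lia), ← hu, Nat.add_sub_cancel' (by lia)]
  have hlinear : (1 - C (conj a) * X : ℂ[X]) = (X - C (conj a)⁻¹) * C (-conj a) := by
    rw [sub_mul, ← C_mul, mul_neg, inv_mul_cancel₀ hconj, C_neg, C_neg, C_1]
    ring
  rw [hfactor, hlinear, mul_pow, mul_assoc]
  exact dvd_mul_right _ _

theorem rootMultiplicity_pstar {N : ℕ} {f : ℂ[X]} (hf : f ≠ 0) (hN : f.natDegree ≤ N) {a : ℂ}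
    (ha : a ≠ 0) : (pstar N f).rootMultiplicity (conj a)⁻¹ = f.rootMultiplicity a := by
  refine le_antisymm ?_ (rootMultiplicity_le_rootMultiplicity_pstar hf hN ha)
  simpa [pstar_pstar] using rootMultiplicity_le_rootMultiplicity_pstar (pstar_ne_zero (N := N) hf)
    (natDegree_pstar_le hN) (inv_ne_zero ((_root_.map_ne_zero (starRingEnd ℂ)).2 ha))

/-! ### Quotients that are nonnegative on the circle -/

/-- `f / p ≥ 0` on the unit circle. The inequality is multiplied by `|p|²`, so that it makes sense
at the zeros of `p`. -/
def IsNonnegQuot (f p : ℂ[X]) : Prop :=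
  ∀ z : ℂ, ‖z‖ = 1 → 0 ≤ f.eval z * conj (p.eval z)

theorem ae_onCircle_ne_zero {p : ℂ[X]} (hp : p ≠ 0) :
    ∀ᵐ t ∂AddCircle.haarAddCircle, onCircle p t ≠ 0 := by
  have hinj : Function.Injective fun t : Arc => (AddCircle.toCircle t : ℂ) :=
    Subtype.val_injective.comp (AddCircle.injective_toCircle Real.two_pi_pos.ne')
  have hfin : {t : Arc | onCircle p t = 0}.Finite := by
    refine ((p.roots.toFinset.finite_toSet).preimage hinj.injOn).subset fun t ht => ?_
    simpa [onCircle, hp] using ht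
  have : Nontrivial Circle := nontrivial_of_ne 1 (-1) (by simp [Circle.ext_iff, self_eq_neg])
  have : Nontrivial Arc := (AddCircle.homeomorphCircle Real.two_pi_pos.ne').toEquiv.nontrivial
  simpa [ae_iff] using hfin.measure_zero AddCircle.haarAddCircle

theorem exists_exp_eq {z : ℂ} (hz : ‖z‖ = 1) :
    ∃ t ∈ Set.Ioc (-π) π, Complex.exp ((t : ℝ) * Complex.I) = z :=
  ⟨z.arg, Complex.arg_mem_Ioc z, by simpa [hz] using Complex.norm_mul_exp_arg_mul_I z⟩

theorem coe_toCircle (t : ℝ) :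
    (AddCircle.toCircle (t : Arc) : ℂ) = Complex.exp (t * Complex.I) := by
  simp [AddCircle.toCircle_apply_mk, Circle.coe_exp]

theorem isNonnegQuot_iff_ae {f p : ℂ[X]} : IsNonnegQuot f p ↔
    ∀ᵐ t : Arc ∂AddCircle.haarAddCircle,
      0 ≤ onCircle f t * conj (onCircle p t) := by
  refine ⟨fun h => .of_forall fun t => h _ (Circle.norm_coe _), fun h z hz => ?_⟩
  have hclosed : IsClosed {t : Arc | 0 ≤ onCircle f t * conj (onCircle p t)} :=
    isClosed_le continuous_const (by fun_prop)
  obtain ⟨t, -, rfl⟩ := exists_exp_eq hz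
  rw [← coe_toCircle]
  exact hclosed.closure_subset_iff.2 subset_rfl (Measure.dense_of_ae h (t : Arc))

theorem eq_of_eval_eq_on_circle {f g : ℂ[X]} (h : ∀ z : ℂ, ‖z‖ = 1 → f.eval z = g.eval z) :
    f = g := by
  by_contra hne
  obtain ⟨t, ht⟩ := (ae_onCircle_ne_zero (sub_ne_zero.2 hne)).exists
  exact ht (by simp [onCircle, h _ (Circle.norm_coe _)])

namespace IsNonnegQuot

variable {f g p q : ℂ[X]}

protected theorem refl (f : ℂ[X]) : IsNonnegQuot f f := fun _ _ => mul_star_self_nonneg _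

protected theorem symm (h : IsNonnegQuot f p) : IsNonnegQuot p f := fun z hz => by
  simpa [mul_comm] using star_nonneg_iff.2 (h z hz)

protected theorem mul (h : IsNonnegQuot f p) (h' : IsNonnegQuot g q) :
    IsNonnegQuot (f * g) (p * q) := fun z hz => by
  rw [eval_mul, eval_mul, map_mul, mul_mul_mul_comm]
  exact mul_nonneg (h z hz) (h' z hz)

protected theorem pow (h : IsNonnegQuot f p) (n : ℕ) : IsNonnegQuot (f ^ n) (p ^ n) := by
  induction n with
  | zero => simpa using IsNonnegQuot.refl 1
  | succ n ih => simpa only [pow_succ] using ih.mul h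

theorem prod {ι : Type*} {s : Finset ι} {F P : ι → ℂ[X]} (h : ∀ i ∈ s, IsNonnegQuot (F i) (P i)) :
    IsNonnegQuot (∏ i ∈ s, F i) (∏ i ∈ s, P i) := by
  classical
  induction s using Finset.induction_on with
  | empty => simpa using IsNonnegQuot.refl 1
  | insert i s hi ih =>
    rw [Finset.prod_insert hi, Finset.prod_insert hi]
    exact (h i (s.mem_insert_self i)).mul (ih fun j hj => h j (Finset.mem_insert_of_mem hj))

theorem of_mul_right (hg : g ≠ 0) (h : IsNonnegQuot (f * g) (p * g)) : IsNonnegQuot f p := by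
  refine isNonnegQuot_iff_ae.2 ((ae_onCircle_ne_zero hg).mono fun t ht => ?_)
  have hpos : 0 < onCircle g t * conj (onCircle g t) :=
    (mul_star_self_nonneg _).lt_of_ne' (mul_ne_zero ht (star_ne_zero.2 ht))
  refine le_of_mul_le_mul_right ?_ hpos
  rw [zero_mul, mul_mul_mul_comm, ← map_mul]
  simpa [onCircle] using h _ (Circle.norm_coe (AddCircle.toCircle t))

protected theorem trans (hg : g ≠ 0) (h : IsNonnegQuot f g) (h' : IsNonnegQuot g p) :
    IsNonnegQuot f p :=
  of_mul_right hg (by simpa only [mul_comm g p] using h.mul h')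

theorem mul_pstar_eq {N : ℕ} (hf : f.natDegree ≤ N) (hp : p.natDegree ≤ N)
    (h : IsNonnegQuot f p) : f * pstar N p = pstar N f * p := by
  refine eq_of_eval_eq_on_circle fun z hz => ?_
  have hreal : conj (f.eval z * conj (p.eval z)) = f.eval z * conj (p.eval z) :=
    (IsSelfAdjoint.of_nonneg (h z hz)).star_eq
  rw [map_mul, Complex.conj_conj] at hreal
  rw [eval_mul, eval_mul, eval_pstar hp hz, eval_pstar hf hz]
  linear_combination -z ^ N * hreal

theorem natDegree_add_rootMultiplicity_zero (hf : f ≠ 0) (hp : p ≠ 0) (h : IsNonnegQuot f p) :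
    f.natDegree + f.rootMultiplicity 0 = p.natDegree + p.rootMultiplicity 0 := by
  set N := max f.natDegree p.natDegree
  have hfN : f.natDegree ≤ N := le_max_left _ _
  have hpN : p.natDegree ≤ N := le_max_right _ _
  have hmult := congrArg (rootMultiplicity 0) (h.mul_pstar_eq hfN hpN)
  rw [rootMultiplicity_mul (mul_ne_zero hf (pstar_ne_zero hp)),
    rootMultiplicity_mul (mul_ne_zero (pstar_ne_zero hf) hp)] at hmult
  have hf₀ := rootMultiplicity_zero_pstar hf hfN
  have hp₀ := rootMultiplicity_zero_pstar hp hpN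
  lia

theorem natDegree_add_rootMultiplicity_zero_of_X_pow {d : ℕ} (hf : f ≠ 0)
    (h : IsNonnegQuot f (X ^ d)) : f.natDegree + f.rootMultiplicity 0 = 2 * d := by
  have hX : (X ^ d : ℂ[X]).rootMultiplicity 0 = d := by
    simpa using rootMultiplicity_X_sub_C_pow (0 : ℂ) d
  rw [h.natDegree_add_rootMultiplicity_zero hf (pow_ne_zero d X_ne_zero), hX, natDegree_X_pow,
    two_mul]

theorem natDegree_le {d : ℕ} (h : IsNonnegQuot f (X ^ d)) : f.natDegree ≤ 2 * d := by
  rcases eq_or_ne f 0 with rfl | hf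
  · simp
  · exact (Nat.le_add_right _ _).trans_eq (h.natDegree_add_rootMultiplicity_zero_of_X_pow hf)

theorem pstar_eq_self {d : ℕ} (h : IsNonnegQuot f (X ^ d)) : pstar (2 * d) f = f := by
  have hX : pstar (2 * d) (X ^ d) = X ^ d := by simp [pstar, two_mul]
  have hcomm := h.mul_pstar_eq h.natDegree_le (by simp; lia)
  rw [hX] at hcomm
  exact (mul_right_cancel₀ (pow_ne_zero d X_ne_zero) hcomm).symm

end IsNonnegQuot

theorem eq_zero_of_mul_nonneg_of_sign_change {H : ℝ → ℂ} {s : ℝ → ℝ} (hH : ContinuousAt H 0)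
    (hpos : ∀ᶠ t in 𝓝[>] 0, 0 < s t) (hneg : ∀ᶠ t in 𝓝[<] 0, s t < 0)
    (h : ∀ t, 0 ≤ H t * s t) : H 0 = 0 := by
  refine le_antisymm (le_of_tendsto (hH.mono_left nhdsWithin_le_nhds) (hneg.mono fun t ht => ?_))
    (ge_of_tendsto (hH.mono_left nhdsWithin_le_nhds) (hpos.mono fun t ht => ?_))
  · have hs : (0 : ℂ) < -s t := by exact_mod_cast neg_pos.2 ht
    refine neg_nonneg.1 (le_of_mul_le_mul_right ?_ hs)
    rw [zero_mul, neg_mul_neg]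
    exact h t
  · have hs : (0 : ℂ) < s t := by exact_mod_cast ht
    refine le_of_mul_le_mul_right ?_ hs
    rw [zero_mul]
    exact h t

theorem mul_exp_sq_sub_self (a : ℂ) (t : ℝ) :
    a * Complex.exp (t * Complex.I) ^ 2 - a =
      a * Complex.exp (t * Complex.I) * (2 * Complex.I) * Real.sin t := by
  rw [Complex.exp_mul_I, Complex.ofReal_sin]
  linear_combination a * Complex.sin_sq_add_cos_sq (t : ℂ) - a * Complex.sin t ^ 2 * Complex.I_sq

/-- Across a zero `a` of odd order of `f p` the function `f conj p` changes sign along the circle: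
in the half-angle parametrization `z = a e^(2it)`, the factor `z - a` is `sin t` times a function
without zeros. -/
theorem IsNonnegQuot.even_rootMultiplicity_add {f p : ℂ[X]} (hf : f ≠ 0) (hp : p ≠ 0)
    (h : IsNonnegQuot f p) {a : ℂ} (ha : ‖a‖ = 1) :
    Even (f.rootMultiplicity a + p.rootMultiplicity a) := by
  obtain ⟨u, hu, hua⟩ := exists_eq_pow_rootMultiplicity_mul_and_not_dvd f hf a
  obtain ⟨v, hv, hva⟩ := exists_eq_pow_rootMultiplicity_mul_and_not_dvd p hp a
  set m := f.rootMultiplicity a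
  set n := p.rootMultiplicity a
  rw [dvd_iff_isRoot, IsRoot.def] at hua hva
  by_contra hodd
  rw [Nat.not_even_iff_odd] at hodd
  let e (t : ℝ) : ℂ := Complex.exp (t * Complex.I)
  let z (t : ℝ) : ℂ := a * e t ^ 2
  let w (t : ℝ) : ℂ := a * e t * (2 * Complex.I)
  let H (t : ℝ) : ℂ := w t ^ m * u.eval (z t) * conj (w t ^ n * v.eval (z t))
  have hzw (t : ℝ) : z t - a = w t * Real.sin t := mul_exp_sq_sub_self a t
  have hcont : Continuous H := by fun_prop
  have hH₀ : H 0 = 0 := by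
    refine eq_zero_of_mul_nonneg_of_sign_change hcont.continuousAt
      (s := fun t => Real.sin t ^ (m + n)) ?_ ?_ fun t => ?_
    · filter_upwards [Ioo_mem_nhdsGT Real.pi_pos] with t ht
      exact pow_pos (Real.sin_pos_of_mem_Ioo ht) _
    · filter_upwards [Ioo_mem_nhdsLT (neg_lt_zero.2 Real.pi_pos)] with t ht
      exact hodd.pow_neg (Real.sin_neg_of_neg_of_neg_pi_lt ht.2 ht.1)
    · have hz : ‖z t‖ = 1 := by simp [z, e, ha, Complex.norm_exp_ofReal_mul_I]
      convert h (z t) hz using 1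
      rw [hu, hv]
      simp only [H, eval_mul, eval_pow, eval_sub, eval_X, eval_C, hzw, map_mul, map_pow,
        Complex.conj_ofReal, Complex.ofReal_pow]
      ring
  have ha₀ : a ≠ 0 := norm_pos_iff.1 (ha ▸ one_pos)
  simp [H, z, w, e, ha₀, hua, hva] at hH₀

/-! ### The factorization `p = G̃ R̃` -/

theorem dvd_of_rootMultiplicity_le {K : Type*} [Field K] [IsAlgClosed K] {f g : K[X]} (hf : f ≠ 0)
    (hg : g ≠ 0) (h : ∀ a, f.rootMultiplicity a ≤ g.rootMultiplicity a) : f ∣ g := by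
  classical
  rw [IsAlgClosed.dvd_iff_roots_le_roots hf hg, Multiset.le_iff_count]
  simpa [count_roots] using h

theorem rootMultiplicity_pow {R : Type*} [CommRing R] [IsDomain R] (f : R[X]) (a : R) (r : ℕ) :
    (f ^ r).rootMultiplicity a = r * f.rootMultiplicity a := by
  classical
  rw [← count_roots, roots_pow, Multiset.count_nsmul, count_roots]

theorem rootMultiplicity_prod {R ι : Type*} [CommRing R] [IsDomain R] {s : Finset ι} {f : ι → R[X]}
    (hf : ∀ i ∈ s, f i ≠ 0) (a : R) :
    (∏ i ∈ s, f i).rootMultiplicity a = ∑ i ∈ s, (f i).rootMultiplicity a := by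
  classical
  simp only [← count_roots, roots_prod _ _ (Finset.prod_ne_zero_iff.2 hf), Multiset.bind,
    Multiset.join, Multiset.count_sum, Finset.sum]

/-- The polynomial `(z - b)(1 - conj(b) z)`, which for `|b| < 1` has the zero `b` and its
reflection in the unit circle, and for `|b| = 1` the double zero `b`. -/
noncomputable def reciprocalFactor (b : ℂ) : ℂ[X] := (X - C b) * (1 - C (conj b) * X)

theorem one_sub_C_mul_X_ne_zero (b : ℂ) : (1 - C b * X : ℂ[X]) ≠ 0 := fun h => by
  simpa using congrArg (eval 0) h

theorem reciprocalFactor_ne_zero (b : ℂ) : reciprocalFactor b ≠ 0 :=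
  mul_ne_zero (X_sub_C_ne_zero b) (one_sub_C_mul_X_ne_zero _)

theorem isNonnegQuot_reciprocalFactor_X (b : ℂ) : IsNonnegQuot (reciprocalFactor b) X := by
  intro z hz
  have hconj : z * conj z = 1 := by rw [Complex.mul_conj', hz]; simp
  have : (reciprocalFactor b).eval z * conj z = (z - b) * conj (z - b) := by
    simp only [reciprocalFactor, eval_mul, eval_sub, eval_X, eval_C, eval_one, map_sub]
    linear_combination - (z - b) * conj b * hconj
  rw [eval_X, this]
  exact mul_star_self_nonneg _

theorem rootMultiplicity_one_sub_C_conj_mul_X {a b : ℂ} (ha : ‖a‖ ≤ 1) (hb : ‖b‖ ≤ 1) :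
    (1 - C (conj b) * X).rootMultiplicity a =
      open Classical in if a = b ∧ ‖b‖ = 1 then 1 else 0 := by
  split_ifs with h
  · obtain ⟨rfl, h⟩ := h
    have hconj : conj a * a = 1 := by rw [Complex.conj_mul', h]; simp
    have hlinear : (1 - C (conj a) * X : ℂ[X]) = C (-conj a) * (X - C a) := by
      rw [mul_sub, ← C_mul, neg_mul, hconj, C_neg, C_neg, C_1]
      ring
    rw [hlinear, rootMultiplicity_mul (hlinear ▸ one_sub_C_mul_X_ne_zero _), rootMultiplicity_C,
      rootMultiplicity_X_sub_C_self]
  · refine rootMultiplicity_eq_zero fun hroot => h ?_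
    have hconj : conj b * a = 1 := by
      simp only [IsRoot.def, eval_sub, eval_one, eval_mul, eval_C, eval_X] at hroot
      exact (sub_eq_zero.1 hroot).symm
    have hnorm : ‖b‖ * ‖a‖ = 1 := by simpa using congrArg norm hconj
    have hb₁ : ‖b‖ = 1 := le_antisymm hb (by nlinarith [norm_nonneg b])
    refine ⟨?_, hb₁⟩
    have hbb : conj b * b = 1 := by rw [Complex.conj_mul', hb₁]; simp
    exact mul_left_cancel₀ (left_ne_zero_of_mul_eq_one hbb) (hconj.trans hbb.symm)

theorem rootMultiplicity_reciprocalFactor {a b : ℂ} (ha : ‖a‖ ≤ 1) (hb : ‖b‖ ≤ 1) :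
    (reciprocalFactor b).rootMultiplicity a =
      open Classical in if a = b then (if ‖a‖ = 1 then 2 else 1) else 0 := by
  classical
  rw [reciprocalFactor, rootMultiplicity_mul (reciprocalFactor_ne_zero b), rootMultiplicity_X_sub_C,
    rootMultiplicity_one_sub_C_conj_mul_X ha hb]
  split_ifs <;> simp_all

/-- The self-reciprocal polynomial whose zeros in the closed disk are the `b ∈ s`, each with
multiplicity `e b`, doubled if `|b| = 1`. -/
noncomputable def reciprocalProd (s : Finset ℂ) (e : ℂ → ℕ) : ℂ[X] :=
  ∏ b ∈ s, reciprocalFactor b ^ e b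

theorem reciprocalProd_ne_zero (s : Finset ℂ) (e : ℂ → ℕ) : reciprocalProd s e ≠ 0 :=
  Finset.prod_ne_zero_iff.2 fun b _ => pow_ne_zero _ (reciprocalFactor_ne_zero b)

theorem isNonnegQuot_reciprocalProd (s : Finset ℂ) (e : ℂ → ℕ) :
    IsNonnegQuot (reciprocalProd s e) (X ^ ∑ b ∈ s, e b) := by
  rw [← Finset.prod_pow_eq_pow_sum]
  exact .prod fun b _ => (isNonnegQuot_reciprocalFactor_X b).pow (e b)

theorem rootMultiplicity_reciprocalProd {s : Finset ℂ} (hs : ∀ b ∈ s, ‖b‖ ≤ 1) (e : ℂ → ℕ) {a : ℂ}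
    (ha : ‖a‖ ≤ 1) :
    (reciprocalProd s e).rootMultiplicity a =
      open Classical in if a ∈ s then (if ‖a‖ = 1 then 2 * e a else e a) else 0 := by
  classical
  have hfactor : ∀ b ∈ s, (reciprocalFactor b ^ e b).rootMultiplicity a =
      if a = b then (if ‖a‖ = 1 then 2 * e a else e a) else 0 := fun b hb => by
    rw [rootMultiplicity_pow, rootMultiplicity_reciprocalFactor ha (hs b hb)]
    split_ifs with hab <;> simp [hab, mul_comm]
  rw [reciprocalProd, rootMultiplicity_prod fun b _ => pow_ne_zero _ (reciprocalFactor_ne_zero b),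
    Finset.sum_congr rfl hfactor, Finset.sum_ite_eq]

theorem GTilde_eq (N : ℕ) (p : ℂ[X]) :
    GTilde N p = reciprocalProd (diskZeros N p) (diskMult N p) *
      reciprocalProd (circleZeros p) (circleMult p) := by
  simp only [GTilde, G, G₀, reciprocalProd, reciprocalFactor, mul_pow]

theorem GTilde_ne_zero (N : ℕ) (p : ℂ[X]) : GTilde N p ≠ 0 := by
  rw [GTilde_eq]
  exact mul_ne_zero (reciprocalProd_ne_zero _ _) (reciprocalProd_ne_zero _ _)

theorem isNonnegQuot_GTilde (N : ℕ) (p : ℂ[X]) : IsNonnegQuot (GTilde N p) (X ^ mTilde N p) := by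
  rw [GTilde_eq, mTilde, pow_add]
  exact (isNonnegQuot_reciprocalProd _ _).mul (isNonnegQuot_reciprocalProd _ _)

theorem mem_diskZeros {N : ℕ} {p : ℂ[X]} (hp : p ≠ 0) {a : ℂ} :
    a ∈ diskZeros N p ↔ p.IsRoot a ∧ (pstar N p).IsRoot a ∧ ‖a‖ < 1 := by
  simp [diskZeros, hp]

theorem mem_circleZeros {p : ℂ[X]} (hp : p ≠ 0) {a : ℂ} :
    a ∈ circleZeros p ↔ p.IsRoot a ∧ ‖a‖ = 1 := by
  simp [circleZeros, hp]

theorem rootMultiplicity_GTilde {N : ℕ} {p : ℂ[X]} (hp : p ≠ 0) {a : ℂ} (ha : ‖a‖ ≤ 1) :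
    (GTilde N p).rootMultiplicity a =
      if ‖a‖ = 1 then 2 * circleMult p a else diskMult N p a := by
  have hG := GTilde_ne_zero N p
  rw [GTilde_eq] at hG ⊢
  rw [rootMultiplicity_mul hG,
    rootMultiplicity_reciprocalProd (fun b hb => ((mem_diskZeros hp).1 hb).2.2.le) _ ha,
    rootMultiplicity_reciprocalProd (fun b hb => ((mem_circleZeros hp).1 hb).2.le) _ ha]
  simp only [mem_diskZeros hp, mem_circleZeros hp]
  by_cases h : ‖a‖ = 1
  · simp only [h, lt_irrefl, and_false, and_true, if_true, if_false, zero_add]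
    split_ifs with hroot
    · rfl
    · simp [circleMult, rootMultiplicity_eq_zero hroot]
  · simp only [h, lt_of_le_of_ne ha h, and_false, and_true, if_false, add_zero]
    split_ifs with hroot
    · rfl
    · rcases not_and_or.1 hroot with hroot | hroot <;>
        simp [diskMult, rootMultiplicity_eq_zero hroot]

/-- Outside the closed disk this follows by reflection. -/
theorem rootMultiplicity_GTilde_of_norm_ne {N : ℕ} {p : ℂ[X]} (hp : p ≠ 0) (hN : p.natDegree ≤ N)
    {a : ℂ} (ha : ‖a‖ ≠ 1) : (GTilde N p).rootMultiplicity a = diskMult N p a := by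
  rcases ha.lt_or_gt with h | h
  · rw [rootMultiplicity_GTilde hp h.le, if_neg ha]
  have ha₀ : a ≠ 0 := norm_pos_iff.1 (one_pos.trans h)
  have hb : ‖(conj a)⁻¹‖ < 1 := by simpa using inv_lt_one_of_one_lt₀ h
  have hG := isNonnegQuot_GTilde N p
  have hreflect := rootMultiplicity_pstar (GTilde_ne_zero N p) hG.natDegree_le ha₀
  rw [hG.pstar_eq_self] at hreflect
  have hstar := rootMultiplicity_pstar (pstar_ne_zero (N := N) hp) (natDegree_pstar_le hN) ha₀
  rw [pstar_pstar] at hstar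
  rw [← hreflect, rootMultiplicity_GTilde hp hb.le, if_neg hb.ne, diskMult, diskMult, hstar,
    rootMultiplicity_pstar hp hN ha₀, min_comm]

theorem GTilde_dvd {N : ℕ} {p : ℂ[X]} (hp : p ≠ 0) (hN : p.natDegree ≤ N) : GTilde N p ∣ p := by
  refine dvd_of_rootMultiplicity_le (GTilde_ne_zero N p) hp fun a => ?_
  by_cases ha : ‖a‖ = 1
  · rw [rootMultiplicity_GTilde hp ha.le, if_pos ha]
    exact Nat.mul_div_le _ 2
  · rw [rootMultiplicity_GTilde_of_norm_ne hp hN ha]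
    exact min_le_left _ _

theorem GTilde_mul_RTilde {N : ℕ} {p : ℂ[X]} (hp : p ≠ 0) (hN : p.natDegree ≤ N) :
    GTilde N p * RTilde N p = p :=
  EuclideanDomain.mul_div_cancel' (GTilde_ne_zero N p) (GTilde_dvd hp hN)

theorem RTilde_ne_zero {N : ℕ} {p : ℂ[X]} (hp : p ≠ 0) (hN : p.natDegree ≤ N) : RTilde N p ≠ 0 :=
  right_ne_zero_of_mul ((GTilde_mul_RTilde hp hN).symm ▸ hp)

theorem rootMultiplicity_GTilde_add_RTilde {N : ℕ} {p : ℂ[X]} (hp : p ≠ 0) (hN : p.natDegree ≤ N)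
    (a : ℂ) :
    (GTilde N p).rootMultiplicity a + (RTilde N p).rootMultiplicity a = p.rootMultiplicity a := by
  rw [← rootMultiplicity_mul (mul_ne_zero (GTilde_ne_zero N p) (RTilde_ne_zero hp hN)),
    GTilde_mul_RTilde hp hN]

theorem two_mul_mTilde_add_natDegree_RTilde_le {N : ℕ} {p : ℂ[X]} (hp : p ≠ 0)
    (hN : p.natDegree ≤ N) : 2 * mTilde N p + (RTilde N p).natDegree ≤ N := by
  have hG := (isNonnegQuot_GTilde N p).natDegree_add_rootMultiplicity_zero_of_X_pow
    (GTilde_ne_zero N p)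
  have hmult : (GTilde N p).rootMultiplicity 0 ≤ (pstar N p).rootMultiplicity 0 := by
    rw [rootMultiplicity_GTilde_of_norm_ne hp hN (by simp)]
    exact min_le_right _ _
  have hdeg := natDegree_mul (GTilde_ne_zero N p) (RTilde_ne_zero hp hN)
  rw [GTilde_mul_RTilde hp hN] at hdeg
  have hstar := rootMultiplicity_zero_pstar hp hN
  lia

/-- On the circle the zeros of `R̃` are simple, and they are the zeros of odd order of `p`. -/
theorem RTilde_dvd {N : ℕ} {p f : ℂ[X]} (hp : p ≠ 0) (hN : p.natDegree ≤ N) (hf : f.natDegree ≤ N)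
    (h : IsNonnegQuot f p) : RTilde N p ∣ f := by
  rcases eq_or_ne f 0 with rfl | hf₀
  · exact dvd_zero _
  refine dvd_of_rootMultiplicity_le (RTilde_ne_zero hp hN) hf₀ fun a => ?_
  have hsum := rootMultiplicity_GTilde_add_RTilde hp hN a
  by_cases ha : ‖a‖ = 1
  · obtain ⟨r, hr⟩ := h.even_rootMultiplicity_add hf₀ hp ha
    rw [rootMultiplicity_GTilde hp ha.le, if_pos ha, circleMult] at hsum
    lia
  · have hmult := congrArg (rootMultiplicity a) (h.mul_pstar_eq hf hN)
    rw [rootMultiplicity_mul (mul_ne_zero hf₀ (pstar_ne_zero hp)),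
      rootMultiplicity_mul (mul_ne_zero (pstar_ne_zero hf₀) hp)] at hmult
    rw [rootMultiplicity_GTilde_of_norm_ne hp hN ha, diskMult] at hsum
    lia

theorem isNonnegQuot_mul_RTilde_iff {N : ℕ} {p Q : ℂ[X]} (hp : p ≠ 0) (hN : p.natDegree ≤ N) :
    IsNonnegQuot (Q * RTilde N p) p ↔ IsNonnegQuot Q (X ^ mTilde N p) := by
  have hG := isNonnegQuot_GTilde N p
  constructor <;> intro h
  · have hQ : IsNonnegQuot Q (GTilde N p) :=
      .of_mul_right (RTilde_ne_zero hp hN) (by rwa [GTilde_mul_RTilde hp hN])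
    exact hQ.trans (GTilde_ne_zero N p) hG
  · have := (h.trans (pow_ne_zero _ X_ne_zero) hG.symm).mul (.refl (RTilde N p))
    rwa [GTilde_mul_RTilde hp hN] at this

/-! ### The polynomial of a plus-vector -/

/-- The trigonometric polynomial `α₀ + ∑ (α_k cos kt - β_k sin kt)`. -/
noncomputable def trig {d : ℕ} (v : Fin (d + 1) ⊕ Fin d → ℝ) (t : ℝ) : ℝ :=
  v (Sum.inl 0) + ∑ i : Fin d,
    (v (Sum.inl i.succ) * cos (((i : ℝ) + 1) * t) - v (Sum.inr i) * sin (((i : ℝ) + 1) * t))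

/-- The polynomial `∑ α_l (z^(d+l) + z^(d-l)) + i ∑ β_l (z^(d+l) - z^(d-l))`, which on the circle is
`2 z^d` times the trigonometric polynomial of the vector. -/
noncomputable def trigPoly {d : ℕ} : (Fin (d + 1) ⊕ Fin d → ℝ) →ₗ[ℝ] ℂ[X] :=
  Fintype.linearCombination ℝ (Sum.elim (fun l : Fin (d + 1) => X ^ (d + l) + X ^ (d - l))
    fun i : Fin d => C Complex.I * (X ^ (d + (i + 1)) - X ^ (d - (i + 1))))

theorem trigPoly_apply {d : ℕ} (v : Fin (d + 1) ⊕ Fin d → ℝ) :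
    trigPoly v = ∑ l : Fin (d + 1), (v (Sum.inl l) : ℂ) • (X ^ (d + l) + X ^ (d - l)) +
      ∑ i : Fin d, (v (Sum.inr i) * Complex.I) • (X ^ (d + (i + 1)) - X ^ (d - (i + 1))) := by
  simp [trigPoly, Fintype.linearCombination_apply, ← smul_eq_C_mul, mul_smul]

theorem exp_mul_I_pow_add {d l : ℕ} (h : l ≤ d) (t : ℝ) :
    Complex.exp (t * Complex.I) ^ (d + l) + Complex.exp (t * Complex.I) ^ (d - l) =
      Complex.exp (t * Complex.I) ^ d * (2 * cos (l * t)) := by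
  rw [pow_add, pow_sub₀ _ (Complex.exp_ne_zero _) h, ← mul_add, ← Complex.exp_nat_mul _ l,
    ← Complex.exp_neg, Complex.ofReal_cos, Complex.two_cos]
  push_cast
  ring_nf

theorem exp_mul_I_pow_sub {d l : ℕ} (h : l ≤ d) (t : ℝ) :
    Complex.exp (t * Complex.I) ^ (d + l) - Complex.exp (t * Complex.I) ^ (d - l) =
      Complex.exp (t * Complex.I) ^ d * (2 * sin (l * t) * Complex.I) := by
  rw [pow_add, pow_sub₀ _ (Complex.exp_ne_zero _) h, ← mul_sub, ← Complex.exp_nat_mul _ l,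
    ← Complex.exp_neg, Complex.ofReal_sin, Complex.two_sin, mul_assoc _ Complex.I, Complex.I_mul_I]
  push_cast
  ring_nf

theorem eval_trigPoly {d : ℕ} (v : Fin (d + 1) ⊕ Fin d → ℝ) (t : ℝ) :
    (trigPoly v).eval (Complex.exp (t * Complex.I)) =
      Complex.exp (t * Complex.I) ^ d * (2 * trig v t : ℝ) := by
  have hcos (l : Fin (d + 1)) := exp_mul_I_pow_add l.is_le t
  have hsin (i : Fin d) := exp_mul_I_pow_sub (Nat.succ_le_of_lt i.is_lt) t
  simp only [trigPoly_apply, eval_add, eval_sub, eval_smul, eval_finsetSum, eval_pow, eval_X,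
    smul_eq_mul, hcos, hsin]
  rw [Fin.sum_univ_succ, add_assoc, ← Finset.sum_add_distrib, trig]
  simp only [Complex.ofReal_mul, Complex.ofReal_add, Complex.ofReal_sum, mul_add, Finset.mul_sum]
  congr 1
  · simp
    ring
  · refine Finset.sum_congr rfl fun i _ => ?_
    push_cast [Fin.val_succ]
    linear_combination 2 * Complex.exp (t * Complex.I) ^ d * v (Sum.inr i) *
      Complex.sin ((i + 1) * t) * Complex.I_sq

theorem isPlusVector_iff_isNonnegQuot {d : ℕ} {v : Fin (d + 1) ⊕ Fin d → ℝ} :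
    IsPlusVector v ↔ IsNonnegQuot (trigPoly v) (X ^ d) := by
  have heval (t : ℝ) : (trigPoly v).eval (Complex.exp (t * Complex.I)) *
      conj ((X ^ d : ℂ[X]).eval (Complex.exp (t * Complex.I))) = (2 * trig v t : ℝ) := by
    rw [eval_trigPoly, mul_right_comm, eval_pow, eval_X, Complex.mul_conj', norm_pow,
      Complex.norm_exp_ofReal_mul_I]
    simp
  constructor
  · intro hv z hz
    obtain ⟨t, ht, rfl⟩ := exists_exp_eq hz
    rw [heval]
    exact Complex.zero_le_real.2 (mul_nonneg zero_le_two (hv t ht))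
  · intro h t _
    have := h _ (Complex.norm_exp_ofReal_mul_I t)
    rw [heval, Complex.zero_le_real] at this
    exact nonneg_of_mul_nonneg_right this two_pos

theorem natDegree_trigPoly_le {d : ℕ} (v : Fin (d + 1) ⊕ Fin d → ℝ) :
    (trigPoly v).natDegree ≤ 2 * d := by
  rw [trigPoly_apply]
  refine natDegree_add_le_of_degree_le (natDegree_sum_le_of_forall_le _ _ fun l _ => ?_)
    (natDegree_sum_le_of_forall_le _ _ fun i _ => ?_)
  · refine (natDegree_smul_le _ _).trans (natDegree_add_le_of_degree_le ?_ ?_) <;>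
      rw [natDegree_X_pow] <;> lia
  · refine (natDegree_smul_le _ _).trans ((natDegree_sub_le_of_le ?_ ?_).trans_eq (max_self _)) <;>
      rw [natDegree_X_pow] <;> lia

theorem pstar_trigPoly {d : ℕ} (v : Fin (d + 1) ⊕ Fin d → ℝ) :
    pstar (2 * d) (trigPoly v) = trigPoly v := by
  refine eq_of_eval_eq_on_circle fun z hz => ?_
  obtain ⟨t, -, rfl⟩ := exists_exp_eq hz
  have hunit : Complex.exp (t * Complex.I) * conj (Complex.exp (t * Complex.I)) = 1 := by
    rw [Complex.mul_conj', hz]; simp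
  rw [eval_pstar (natDegree_trigPoly_le v) hz, eval_trigPoly, map_mul, map_pow, Complex.conj_ofReal,
    two_mul, pow_add, mul_assoc, ← mul_assoc (_ ^ d) (_ ^ d) (Complex.ofReal _), ← mul_pow, hunit,
    one_pow, one_mul]

theorem coeff_trigPoly_self {d : ℕ} (v : Fin (d + 1) ⊕ Fin d → ℝ) :
    (trigPoly v).coeff d = (2 * v (Sum.inl 0) : ℝ) := by
  have hne (l : ℕ) (hl : l < d) : d ≠ d - (l + 1) := by lia
  simp [trigPoly_apply, coeff_X_pow, Fin.sum_univ_succ, hne]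
  ring

theorem coeff_trigPoly_add {d : ℕ} (v : Fin (d + 1) ⊕ Fin d → ℝ) (i : Fin d) :
    (trigPoly v).coeff (d + (i + 1)) = v (Sum.inl i.succ) + v (Sum.inr i) * Complex.I := by
  have hne (l : ℕ) : d + (i + 1) ≠ d - l := by lia
  simp [trigPoly_apply, coeff_X_pow, Fin.sum_univ_succ, hne, Fin.val_inj]

theorem eq_of_pstar_eq_self {d : ℕ} {P Q : ℂ[X]} (hP : pstar (2 * d) P = P)
    (hQ : pstar (2 * d) Q = Q) (h : ∀ n ≥ d, P.coeff n = Q.coeff n) : P = Q := by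
  ext n
  rcases le_total d n with hn | hn
  · exact h n hn
  · rw [← hP, ← hQ, coeff_pstar _ _ (by lia), coeff_pstar _ _ (by lia), h _ (by lia)]

theorem exists_trigPoly_eq {d : ℕ} {Q : ℂ[X]} (hdeg : Q.natDegree ≤ 2 * d)
    (hQ : pstar (2 * d) Q = Q) : ∃ v : Fin (d + 1) ⊕ Fin d → ℝ, trigPoly v = Q := by
  have hmid : ((Q.coeff d).re : ℂ) = Q.coeff d := by
    refine Complex.conj_eq_iff_re.1 ?_
    conv_rhs => rw [← hQ, coeff_pstar _ _ (by lia), show 2 * d - d = d by lia]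
  refine ⟨Sum.elim (Fin.cons ((Q.coeff d).re / 2) fun i => (Q.coeff (d + (i + 1))).re)
    fun i => (Q.coeff (d + (i + 1))).im, eq_of_pstar_eq_self (pstar_trigPoly _) hQ fun n hn => ?_⟩
  obtain ⟨l, rfl⟩ := Nat.exists_eq_add_of_le hn
  rcases lt_or_ge d l with hl | hl
  · rw [coeff_eq_zero_of_natDegree_lt ((natDegree_trigPoly_le _).trans_lt (by lia)),
      coeff_eq_zero_of_natDegree_lt (hdeg.trans_lt (by lia))]
  cases l with
  | zero =>
    rw [add_zero, coeff_trigPoly_self, ← hmid]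
    simp [mul_div_cancel₀]
  | succ l =>
    rw [coeff_trigPoly_add _ ⟨l, hl⟩]
    exact Complex.re_add_im _

theorem trigPoly_injective {d : ℕ} :
    Function.Injective (trigPoly : (Fin (d + 1) ⊕ Fin d → ℝ) →ₗ[ℝ] ℂ[X]) := by
  refine (injective_iff_map_eq_zero _).2 fun v hv => ?_
  have hzero := coeff_trigPoly_self v
  have hsucc (i : Fin d) := coeff_trigPoly_add v i
  simp only [hv, coeff_zero] at hzero hsucc
  funext x
  rcases x with l | i
  · refine Fin.cases ?_ (fun i => ?_) l
    · simpa using congrArg Complex.re hzero.symm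
    · simpa using congrArg Complex.re (hsucc i).symm
  · simpa using congrArg Complex.im (hsucc i).symm

/-! ### The kernel of the matrix -/

theorem coeff_X_pow_mul_RTilde (N : ℕ) (p : ℂ[X]) (a n : ℕ) :
    (X ^ a * RTilde N p).coeff n = CTilde N p (n - a) := by
  rw [coeff_X_pow_mul', CTilde]
  by_cases h : a ≤ n
  · rw [if_pos h, if_pos (by lia), ← Nat.cast_sub h, Int.toNat_natCast]
  · rw [if_neg h, if_neg (by lia)]

theorem coeff_trigPoly_mul_RTilde (N : ℕ) (p : ℂ[X])
    (v : Fin (mTilde N p + 1) ⊕ Fin (mTilde N p) → ℝ) (n : ℕ) :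
    (trigPoly v * RTilde N p).coeff n =
      ∑ l : Fin (mTilde N p + 1), (v (Sum.inl l) : ℂ) *
        (CTilde N p (n + l - mTilde N p) + CTilde N p (n - l - mTilde N p)) -
      ∑ i : Fin (mTilde N p), v (Sum.inr i) * Complex.I *
        (CTilde N p (n + (i + 1) - mTilde N p) - CTilde N p (n - (i + 1) - mTilde N p)) := by
  have hadd (l : ℕ) : (n : ℤ) - (mTilde N p + l : ℕ) = n - l - mTilde N p := by lia
  have hsub (l : ℕ) (hl : l ≤ mTilde N p) :
      (n : ℤ) - (mTilde N p - l : ℕ) = n + l - mTilde N p := by lia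
  rw [trigPoly_apply, add_mul, Finset.sum_mul, Finset.sum_mul, coeff_add, finsetSum_coeff,
    finsetSum_coeff, sub_eq_add_neg, ← Finset.sum_neg_distrib]
  congr 1 <;> refine Finset.sum_congr rfl fun i _ => ?_
  · rw [smul_mul_assoc, coeff_smul, add_mul, coeff_add, coeff_X_pow_mul_RTilde,
      coeff_X_pow_mul_RTilde, hadd, hsub _ i.is_le, smul_eq_mul, add_comm (CTilde N p _)]
  · rw [smul_mul_assoc, coeff_smul, sub_mul, coeff_sub, coeff_X_pow_mul_RTilde,
      coeff_X_pow_mul_RTilde, hadd, hsub _ (Nat.succ_le_of_lt i.is_lt), smul_eq_mul, ← mul_neg,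
      neg_sub]
    push_cast
    rfl

theorem MTilde_mulVec {N M : ℕ} (k : Fin M → ℕ) (p : ℂ[X])
    (v : Fin (mTilde N p + 1) ⊕ Fin (mTilde N p) → ℝ) :
    (MTilde N k p).mulVec v = Sum.elim (fun j => ((trigPoly v * RTilde N p).coeff (k j)).re)
      fun j => ((trigPoly v * RTilde N p).coeff (k j)).im := by
  funext x
  rcases x with j | j <;>
    simp only [coeff_trigPoly_mul_RTilde, Sum.elim_inl, Sum.elim_inr]
  · simp [MTilde, Matrix.mulVec, dotProduct, plusMatrix, minusMatrix, ATilde, BTilde,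
      mul_comm (v _), sub_eq_add_neg]
  · simp [MTilde, Matrix.mulVec, dotProduct, plusMatrix, minusMatrix, ATilde, BTilde,
      mul_comm (v _), sub_eq_add_neg _ (Finset.sum _ _), ← Finset.sum_neg_distrib, ← mul_neg]

theorem mem_NTilde_iff {N M : ℕ} {k : Fin M → ℕ} {p : ℂ[X]}
    {v : Fin (mTilde N p + 1) ⊕ Fin (mTilde N p) → ℝ} :
    v ∈ NTilde N k p ↔ ∀ j, (trigPoly v * RTilde N p).coeff (k j) = 0 := by
  rw [NTilde, LinearMap.mem_ker, Matrix.mulVecLin_apply, MTilde_mulVec]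
  simp only [funext_iff, Sum.forall, Sum.elim_inl, Sum.elim_inr, Pi.zero_apply, Complex.ext_iff,
    Complex.zero_re, Complex.zero_im, forall_and]

theorem mem_fewnomials_freq_iff {N M : ℕ} {k : Fin M → ℕ} {f : ℂ[X]} :
    f ∈ fewnomials (freq N k) ↔ f.natDegree ≤ N ∧ ∀ j, f.coeff (k j) = 0 := by
  have hmem : f ∈ fewnomials (freq N k) ↔ ∀ n, f.coeff n ≠ 0 → n ≤ N ∧ ∀ j, k j ≠ n := by
    change f.support ⊆ freq N k ↔ _
    simp [Finset.subset_iff, freq]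
  rw [hmem, natDegree_le_iff_coeff_eq_zero]
  constructor
  · refine fun h => ⟨fun n hn => ?_, fun j => ?_⟩
    · exact by_contra fun hne => hn.not_ge (h n hne).1
    · exact by_contra fun hne => (h (k j) hne).2 j rfl
  · rintro ⟨hdeg, hk⟩ n hn
    exact ⟨not_lt.1 fun hlt => hn (hdeg n hlt), fun j hj => hn (hj ▸ hk j)⟩

theorem mem_fewnomials_and_isNonnegQuot_iff {N M : ℕ} {k : Fin M → ℕ} {p f : ℂ[X]} (hp : p ≠ 0)
    (hN : p.natDegree ≤ N) : f ∈ fewnomials (freq N k) ∧ IsNonnegQuot f p ↔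
      ∃ v ∈ NTilde N k p, IsPlusVector v ∧ trigPoly v * RTilde N p = f := by
  constructor
  · rintro ⟨hf, h⟩
    obtain ⟨hdeg, hcoeff⟩ := mem_fewnomials_freq_iff.1 hf
    obtain ⟨Q, rfl⟩ := RTilde_dvd hp hN hdeg h
    rw [mul_comm] at h hcoeff ⊢
    have hQ := (isNonnegQuot_mul_RTilde_iff hp hN).1 h
    obtain ⟨v, rfl⟩ := exists_trigPoly_eq hQ.natDegree_le hQ.pstar_eq_self
    exact ⟨v, mem_NTilde_iff.2 hcoeff, isPlusVector_iff_isNonnegQuot.2 hQ, rfl⟩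
  · rintro ⟨v, hv, hplus, rfl⟩
    refine ⟨mem_fewnomials_freq_iff.2 ⟨?_, mem_NTilde_iff.1 hv⟩,
      (isNonnegQuot_mul_RTilde_iff hp hN).2 (isPlusVector_iff_isNonnegQuot.1 hplus)⟩
    exact natDegree_mul_le.trans ((Nat.add_le_add_right (natDegree_trigPoly_le v) _).trans
      (two_mul_mTilde_add_natDegree_RTilde_le hp hN))

/-! ### Exposed points -/

theorem coeFn_toL1 (f : ℂ[X]) : toL1 f =ᵐ[AddCircle.haarAddCircle] onCircle f :=
  ContinuousMap.coeFn_toLp _ (onCircle f)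

theorem toL1_injective : Function.Injective toL1 := by
  refine (injective_iff_map_eq_zero _).2 fun f hf => by_contra fun hne => ?_
  have hzero := coeFn_toL1 f
  rw [hf] at hzero
  obtain ⟨t, ht, ht₀, htL⟩ :=
    ((ae_onCircle_ne_zero hne).and ((Lp.coeFn_zero ℂ 1 _).and hzero)).exists
  exact ht (htL.symm.trans ht₀)

theorem isExposedPointOfBall_toL1_iff {V : Submodule ℂ ℂ[X]} {p : ℂ[X]} (hp : p ∈ V)
    (hp₁ : ‖toL1 p‖ = 1) :
    IsExposedPointOfBall (⟨toL1 p, Submodule.mem_map_of_mem hp⟩ : V.map toL1) ↔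
      ∀ f ∈ V, IsNonnegQuot f p → ∃ c : ℝ, f = c • p := by
  have hp₀ : p ≠ 0 := by
    rintro rfl
    simp at hp₁
  have hne : ∀ᵐ t ∂AddCircle.haarAddCircle, toL1 p t ≠ 0 := by
    filter_upwards [coeFn_toL1 p, ae_onCircle_ne_zero hp₀] with t ht hpt
    rwa [ht]
  have hquot (f : ℂ[X]) :
      (∀ᵐ t ∂AddCircle.haarAddCircle, 0 ≤ toL1 f t * conj (toL1 p t)) ↔ IsNonnegQuot f p := by
    rw [isNonnegQuot_iff_ae]
    refine eventually_congr ?_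
    filter_upwards [coeFn_toL1 f, coeFn_toL1 p] with t hf hp
    rw [hf, hp]
  have hsmul (f : ℂ[X]) (c : ℝ) : toL1 f = c • toL1 p ↔ f = c • p := by
    rw [← toL1_injective.eq_iff, toL1.map_smul_of_tower]
  have hball := isExposedPointOfBall_iff
    (p := (⟨toL1 p, Submodule.mem_map_of_mem hp⟩ : V.map toL1)) hp₁ hne
  rw [hball]
  constructor
  · intro h f hf hfp
    exact (h ⟨toL1 f, Submodule.mem_map_of_mem hf⟩ ((hquot f).2 hfp)).imp fun c hc =>
      (hsmul f c).1 (congrArg Subtype.val hc)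
  · rintro h ⟨_, f, hf, rfl⟩ hfp
    exact (h f hf ((hquot f).1 hfp)).imp fun c hc => Subtype.ext ((hsmul f c).2 hc)

/-! ### The plus-dimension -/

theorem plusDim_eq_one_iff {d : ℕ} {V : Submodule ℝ (Fin (d + 1) ⊕ Fin d → ℝ)}
    {v₀ : Fin (d + 1) ⊕ Fin d → ℝ} (hv₀ : v₀ ∈ V) (hplus : IsPlusVector v₀) (hne : v₀ ≠ 0) :
    plusDim V = 1 ↔ ∀ v ∈ V, IsPlusVector v → ∃ c : ℝ, v = c • v₀ := by
  obtain ⟨⟨w, hw, hwV⟩, hmax⟩ := isGreatest_plusDim V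
  constructor
  · intro h v hv hvplus
    by_contra! hc
    refine absurd (hmax (a := 2) ⟨![v₀, v], (LinearIndependent.pair_iff' hne).2 fun a ha =>
      hc a ha.symm, Fin.forall_fin_two.2 ⟨⟨hv₀, hplus⟩, hv, hvplus⟩⟩) (by lia)
  · intro h
    refine le_antisymm ?_ (hmax ⟨fun _ => v₀, by simpa using hne, fun _ => ⟨hv₀, hplus⟩⟩)
    have hspan : Submodule.span ℝ (Set.range w) ≤ Submodule.span ℝ {v₀} := by
      refine Submodule.span_le.2 (Set.range_subset_iff.2 fun i => ?_)
      obtain ⟨c, hc⟩ := h (w i) (hwV i).1 (hwV i).2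
      exact Submodule.mem_span_singleton.2 ⟨c, hc.symm⟩
    calc plusDim V = Module.finrank ℝ (Submodule.span ℝ (Set.range w)) := by
          rw [finrank_span_eq_card hw, Fintype.card_fin]
      _ ≤ Module.finrank ℝ (Submodule.span ℝ {v₀}) := Submodule.finrank_mono hspan
      _ = 1 := finrank_span_singleton hne

end Fewnomial

theorem theorem3p1_general {N M : ℕ} {k : Fin M → ℕ} {p : ℂ[X]}
    (hp : p ∈ Fewnomial.fewnomials (Fewnomial.freq N k)) (hp₁ : ‖Fewnomial.toL1 p‖ = 1) :
    Fewnomial.IsExposedPointOfBall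
        (⟨Fewnomial.toL1 p, Submodule.mem_map_of_mem hp⟩ :
          Fewnomial.fewnomialsL1 (Fewnomial.freq N k)) ↔
      Fewnomial.plusDim (Fewnomial.NTilde N k p) = 1 := by
  open Fewnomial in
  have hp₀ : p ≠ 0 := by
    rintro rfl
    simp at hp₁
  have hN : p.natDegree ≤ N := (mem_fewnomials_freq_iff.1 hp).1
  have hiff {f : ℂ[X]} := mem_fewnomials_and_isNonnegQuot_iff (k := k) (f := f) hp₀ hN
  obtain ⟨v₀, hv₀, hplus, hpv⟩ := hiff.1 ⟨hp, .refl p⟩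
  have hne : v₀ ≠ 0 := by
    rintro rfl
    exact hp₀ (by rw [← hpv, map_zero, zero_mul])
  have hsmul (v : Fin (mTilde N p + 1) ⊕ Fin (mTilde N p) → ℝ) (c : ℝ) :
      trigPoly v * RTilde N p = c • p ↔ v = c • v₀ := by
    have hpc : c • p = trigPoly (c • v₀) * RTilde N p := by rw [map_smul, smul_mul_assoc, hpv]
    rw [hpc, mul_left_inj' (RTilde_ne_zero hp₀ hN), trigPoly_injective.eq_iff]
  rw [isExposedPointOfBall_toL1_iff hp hp₁, plusDim_eq_one_iff hv₀ hplus hne]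
  constructor
  · intro h v hv hvplus
    obtain ⟨hf, hfp⟩ := hiff.2 ⟨v, hv, hvplus, rfl⟩
    exact (h _ hf hfp).imp fun c => (hsmul v c).1
  · intro h f hf hfp
    obtain ⟨v, hv, hvplus, rfl⟩ := hiff.1 ⟨hf, hfp⟩
    exact (h v hv hvplus).imp fun c => (hsmul v c).2

theorem theorem3p1 (N M : ℕ) (hN : 0 < N) (k : Fin M → ℕ) (hk : StrictMono k)
    (hk₀ : ∀ j, 0 < k j) (hkN : ∀ j, k j < N)
    (p : Polynomial ℂ) (hp : p ∈ Fewnomial.fewnomials (Fewnomial.freq N k))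
    (hp₁ : ‖Fewnomial.toL1 p‖ = 1) :
    Fewnomial.IsExposedPointOfBall
        (⟨Fewnomial.toL1 p, Submodule.mem_map_of_mem hp⟩ :
          Fewnomial.fewnomialsL1 (Fewnomial.freq N k)) ↔
      Fewnomial.plusDim (Fewnomial.NTilde N k p) = 1 :=
  theorem3p1_general hp hp₁
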